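/- **Theorem (Gauss–Poisson limit theorem on the torus).** Let $\mathbb T=\{e^{ix}:-\pi\le x<\pi\}$ be the multiplicative group of complex numbers of modulus one, with identity $e=1$ and Borel $\sigma$-algebra; its continuous characters are $\chi_\ell(y)=y^\ell$, $\ell\in\mathbb Z$. Let $\arg:\mathbb T\to[-\pi,\pi)$ be given by $\arg(e^{ix})=x$ for $-\pi\le x<\pi$, and define $h:\mathbb R\to\mathbb R$ by $h(x)=0$ if $x<-\pi$ or $x\ge\pi$, $h(x)=-x-\pi$ if $-\pi\le x<-\pi/2$, $h(x)=x$ if $-\pi/2\le x<\pi/2$, and $h(x)=-x+\pi$ if $\pi/2\le x<\pi$. Put $g_{\mathbb T}(y,\chi_\ell)=\ell\,h(\arg y)$ and, for $b\ge 0$, $\psi_b(\chi_\ell)=b\ell^2$. A (nonnegative, possibly infinite) Borel measure $\eta$ on $\mathbb T$ is a *Lévy measure* if $\eta(\{e\})=0$, $\eta(\mathbb T\setminus U)<\infty$ for every Borel neighbourhood $U$ of $e$, and $\int_{\mathbb T}(1-\operatorname{Re}\chi)\,d\eta<\infty$ for every continuous character $\chi$. For $b\ge0$ and a Lévy measure $\eta$,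 $\gamma_{\psi_b}$ and $\pi_{\eta,g_{\mathbb T}}$ denote the unique Borel probability measures on $\mathbb T$ with $$\int_{\mathbb T}\chi_\ell\,d\gamma_{\psi_b}=e^{-\psi_b(\chi_\ell)/2},\qquad \int_{\mathbb T}\chi_\ell\,d\pi_{\eta,g_{\mathbb T}}=\exp\Big\{\int_{\mathbb T}\big(\chi_\ell(y)-1-i\,g_{\mathbb T}(y,\chi_\ell)\big)\,d\eta(y)\Big\}\qquad(\ell\in\mathbb Z);$$ their existence and uniqueness, and the integrability of the integrand in the second exponent, are part of the assertion. Let $\{X_{n,k}:n\in\mathbb N,\ k=1,\dots,K_n\}$ be an array of random elements of $\mathbb T$ such that, for each $n$, $X_{n,1},\dots,X_{n,K_n}$ are independent. Suppose that there are $a\in\mathbb T$, $b\ge0$ and a Lévy measure $\eta$ on $\mathbb T$ such that, as $n\to\infty$, 1. $\max_{1\le k\le K_n}\mathrm P(|\arg(X_{n,k})|>\varepsilon)\to0$ for all $\varepsilon>0$; 2. $\exp\big\{i\sum_{k=1}^{K_n}\mathrm E\,h(\arg(X_{n,k}))\big\}\to a$; 3. $\sum_{k=1}^{K_n}\operatorname{Var}h(\arg(X_{n,k}))\to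 b+\int_{\mathbb T}(h(\arg y))^2\,d\eta(y)$; 4. $\sum_{k=1}^{K_n}\mathrm E\,f(X_{n,k})\to\int_{\mathbb T}f\,d\eta$ for every bounded continuous $f:\mathbb T\to\mathbb R$ that vanishes in some neighbourhood of $e$. Then the array is infinitesimal, that is, $\max_{1\le k\le K_n}\mathrm P(X_{n,k}\notin U)\to0$ for every Borel neighbourhood $U$ of $e$, and the row sums converge in distribution (the group operation being multiplication in $\mathbb T$): $$\sum_{k=1}^{K_n}X_{n,k}\ \xrightarrow{\ \mathcal D\ }\ \delta_a*\gamma_{\psi_b}*\pi_{\eta,g_{\mathbb T}}\qquad\text{as }n\to\infty.$$ -/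

import Mathlib

open MeasureTheory ProbabilityTheory Filter Topology

/-! ### Notions on a general commutative topological group -/

/-- The Fourier transform `χ ↦ ∫ χ dμ` of a measure on `G`, as a function on the group of
continuous characters of `G`. -/
noncomputable def fourierTransform {G : Type*} [CommGroup G] [TopologicalSpace G]
    [MeasurableSpace G] (μ : Measure G) (χ : PontryaginDual G) : ℂ :=
  ∫ x, ((χ x : Circle) : ℂ) ∂μ

/-- Lévy measures: no mass at the identity, finite mass off every Borel neighbourhood of the
identity, and `∫ (1 - Re χ) dη < ∞` for every continuous character `χ`. The integrand is
nonnegative, so the last condition is stated with the integral of nonnegative functions. -/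
structure IsLevyMeasure {G : Type*} [CommGroup G] [TopologicalSpace G] [MeasurableSpace G]
    (η : Measure G) : Prop where
  measure_one : η {1} = 0
  measure_compl_lt_top : ∀ U ∈ 𝓝 (1 : G), MeasurableSet U → η Uᶜ < ⊤
  lintegral_lt_top : ∀ χ : PontryaginDual G,
    ∫⁻ x, ENNReal.ofReal (1 - ((χ x : Circle) : ℂ).re) ∂η < ⊤

/-- Infinitesimality of a triangular array `X n k`, `k < K n`, whose `n`-th row lives on the
probability space `(Ω n, P n)`: the maximum over the `n`-th row of `P (X n k ∉ U)` tends to `0`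
for every Borel neighbourhood `U` of the identity. -/
def IsInfinitesimal {G : Type*} [CommGroup G] [TopologicalSpace G] [MeasurableSpace G]
    {K : ℕ → ℕ} {Ω : ℕ → Type*} [∀ n, MeasurableSpace (Ω n)] (P : (n : ℕ) → Measure (Ω n))
    (X : (n : ℕ) → Fin (K n) → Ω n → G) : Prop :=
  ∀ U ∈ 𝓝 (1 : G), MeasurableSet U →
    Tendsto (fun n => ⨆ k : Fin (K n), (P n).real {ω | X n k ω ∉ U}) atTop (𝓝 0)

/-! ### The torus, which is `Circle` -/

noncomputable instance : MeasurableSpace Circle := borel Circle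

instance : BorelSpace Circle := ⟨rfl⟩

/-- The character `χ_ℓ : y ↦ y ^ ℓ` of the torus; every continuous character is of this form for
a unique integer `ℓ`. -/
noncomputable def torusChar (ℓ : ℤ) : PontryaginDual Circle :=
  (⟨zpowGroupHom ℓ, continuous_zpow ℓ⟩ : Circle →ₜ* Circle)

/-- The argument of a point of the torus, with values in `[-π, π)` (Mathlib's `Complex.arg` takes
values in `(-π, π]`). -/
noncomputable def torusArg (y : Circle) : ℝ :=
  if Complex.arg (y : ℂ) = Real.pi then -Real.pi else Complex.arg (y : ℂ)

theorem torusArg_exp {x : ℝ} (h₁ : -Real.pi ≤ x) (h₂ : x < Real.pi) :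
    torusArg (Circle.exp x) = x := by
  rcases h₁.eq_or_lt with rfl | h
  · simp [torusArg]
  · have : Complex.arg (Circle.exp x : ℂ) = x := Circle.arg_exp h h₂.le
    rw [torusArg, this, if_neg h₂.ne]

/-- The truncation function `h`. -/
noncomputable def torusTrunc (x : ℝ) : ℝ :=
  if x < -Real.pi ∨ Real.pi ≤ x then 0
  else if x < -(Real.pi / 2) then -x - Real.pi
  else if x < Real.pi / 2 then x
  else -x + Real.pi

/-- The local inner product `g(y, χ_ℓ) = ℓ h(arg y)` of the torus. -/
noncomputable def torusInner (y : Circle) (ℓ : ℤ) : ℝ := ℓ * torusTrunc (torusArg y)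

/-- The quadratic form `ψ_b(χ_ℓ) = b ℓ²` on the dual of the torus, which is identified with `ℤ`. -/
def torusQuadraticForm (b : ℝ) (ℓ : ℤ) : ℝ := b * (ℓ : ℝ) ^ 2

/-- `γ` has the Fourier transform `exp (-ψ_b / 2)` of the symmetric Gauss measure. -/
def IsTorusGauss (b : ℝ) (γ : ProbabilityMeasure Circle) : Prop :=
  ∀ ℓ : ℤ, fourierTransform (γ : Measure Circle) (torusChar ℓ) =
    Complex.exp (-((torusQuadraticForm b ℓ : ℝ) : ℂ) / 2)

/-- `ρ` has the Fourier transform `χ ↦ exp ∫ (χ(y) - 1 - i g(y, χ)) dη(y)` of the generalized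
Poisson measure; the integral in the exponent is required to converge. -/
def IsTorusGeneralizedPoisson (η : Measure Circle) (ρ : ProbabilityMeasure Circle) : Prop :=
  ∀ ℓ : ℤ,
    Integrable (fun y : Circle =>
      ((torusChar ℓ y : Circle) : ℂ) - 1 - Complex.I * (torusInner y ℓ : ℂ)) η ∧
    fourierTransform (ρ : Measure Circle) (torusChar ℓ) =
      Complex.exp (∫ y : Circle,
        (((torusChar ℓ y : Circle) : ℂ) - 1 - Complex.I * (torusInner y ℓ : ℂ)) ∂η)

/-!
On the compact group `Circle`, weak convergence of probability measures is convergence of their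
Fourier coefficients (`tendsto_of_tendsto_fourierTransform`), since trigonometric polynomials
separate points and tightness is automatic. Compactness also shows that a pointwise limit of Fourier
transforms is a Fourier transform (`exists_fourierTransform_eq_of_tendsto`). This yields the
generalized Poisson measures: binomial approximations converge to compound Poisson measures, whose
translates give the case of a finite `η`, and restricting `η` to complements of small neighbourhoods
of the identity gives the general case. The Gauss measure is a wrapped normal distribution.

For the limit theorem, the function `h` satisfies `h(arg y) = arcsin (Im y)`; hence
`localLog y = h(arg y)` is continuous, and `y ^ ℓ = exp (i ℓ localLog y)` whenever `0 ≤ Re y`. Write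
`H` for the local logarithm of a summand, `m` for its mean, `R` for the second-order remainder of
`s ↦ exp (i s)` at `0`, and `D` for `farPart ℓ`, the difference `y ^ ℓ - exp (i ℓ localLog y)`, which
vanishes near the identity. Then the Fourier transform of the summand at `ℓ` is
`exp (i ℓ m) (1 + z)`, where
`z = E R(ℓ (H - m)) - ℓ² Var H / 2 + exp (-i ℓ m) E D` (`integral_coe_zpow_eq`).
The factors `exp (i ℓ m)` multiply to a sequence converging to `a ^ ℓ`. In `z` everything is centred,
because the sums of `m²` over the rows may be unbounded although those of the variances converge.

The variances converge by assumption; the terms with `D` converge by vague convergence and because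
`m` is uniformly small; the terms with `R` converge by vague convergence away from the identity,
while near the identity `|R(ℓ (H - m))|` is at most a small multiple of `(H - m)²`. Thus the row sums
of `z` converge to the exponent of the limit. Since the `z` are uniformly small with bounded absolute
row sums and `|1 + z| ≤ 1`, the products of `1 + z` converge to the exponential of the limit of the
sums (`tendsto_prod_one_add`).
-/

/-! ### Fourier transforms and weak convergence on the torus -/

theorem coe_torusChar (ℓ : ℤ) (y : Circle) : ((torusChar ℓ y : Circle) : ℂ) = (y : ℂ) ^ ℓ := by
  change ((y ^ ℓ : Circle) : ℂ) = _
  simp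

theorem fourierTransform_torusChar (μ : Measure Circle) (ℓ : ℤ) :
    fourierTransform μ (torusChar ℓ) = ∫ y : Circle, (y : ℂ) ^ ℓ ∂μ := by
  simp only [fourierTransform, coe_torusChar]

theorem continuous_coe_zpow (ℓ : ℤ) : Continuous fun y : Circle => (y : ℂ) ^ ℓ := by
  simp_rw [← Circle.coe_zpow]
  exact continuous_subtype_val.comp (continuous_zpow ℓ)

theorem integrable_coe_zpow (μ : Measure Circle) [IsFiniteMeasure μ] (ℓ : ℤ) :
    Integrable (fun y : Circle => (y : ℂ) ^ ℓ) μ :=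
  .of_bound (continuous_coe_zpow ℓ).aestronglyMeasurable 1 (ae_of_all _ fun y => by
    rw [norm_zpow, Circle.norm_coe, one_zpow])

/-- The character `y ↦ y ^ ℓ` of the torus as a bounded continuous complex function. -/
noncomputable def torusCharBounded (ℓ : ℤ) : BoundedContinuousFunction Circle ℂ :=
  .mkOfCompact ⟨fun y => (y : ℂ) ^ ℓ, continuous_coe_zpow ℓ⟩

@[simp]
theorem torusCharBounded_apply (ℓ : ℤ) (y : Circle) : torusCharBounded ℓ y = (y : ℂ) ^ ℓ := rfl

/-- The star algebra of trigonometric polynomials on the torus. -/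
noncomputable def trigPolynomials : StarSubalgebra ℂ (BoundedContinuousFunction Circle ℂ) where
  toSubalgebra := Algebra.adjoin ℂ (Set.range torusCharBounded)
  star_mem' := by
    change Algebra.adjoin ℂ (Set.range torusCharBounded) ≤
      star (Algebra.adjoin ℂ (Set.range torusCharBounded))
    refine Algebra.adjoin_le ?_
    rintro - ⟨ℓ, rfl⟩
    refine Algebra.subset_adjoin ⟨-ℓ, ?_⟩
    ext y
    simp [← Circle.coe_inv_eq_conj]

theorem trigPolynomials_eq_span :
    Subalgebra.toSubmodule trigPolynomials.toSubalgebra =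
      Submodule.span ℂ (Set.range torusCharBounded) := by
  refine Algebra.adjoin_eq_span_of_subset ℂ ?_
  refine Set.Subset.trans (fun f hf => ?_) Submodule.subset_span
  induction hf using Submonoid.closure_induction with
  | mem f hf => exact hf
  | one => exact ⟨0, by ext y; simp⟩
  | mul f g _ _ hf hg =>
    obtain ⟨k, rfl⟩ := hf
    obtain ⟨l, rfl⟩ := hg
    exact ⟨k + l, by ext y; simp [zpow_add₀]⟩

/-- Convergence of the Fourier coefficients is convergence of the integrals of trigonometric
polynomials. -/
theorem tendsto_integral_trigPolynomial {ι : Type*} {F : Filter ι}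
    {μ : ι → ProbabilityMeasure Circle} {μ₀ : ProbabilityMeasure Circle}
    (h : ∀ ℓ : ℤ, Tendsto (fun i => fourierTransform (μ i : Measure Circle) (torusChar ℓ)) F
      (𝓝 (fourierTransform (μ₀ : Measure Circle) (torusChar ℓ))))
    {g : BoundedContinuousFunction Circle ℂ} (hg : g ∈ trigPolynomials) :
    Tendsto (fun i => ∫ y, g y ∂(μ i : Measure Circle)) F
      (𝓝 (∫ y, g y ∂(μ₀ : Measure Circle))) := by
  have hg' : g ∈ Submodule.span ℂ (Set.range torusCharBounded) := by
    rw [← trigPolynomials_eq_span]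
    exact hg
  clear hg
  induction hg' using Submodule.span_induction with
  | mem f hf =>
    obtain ⟨ℓ, rfl⟩ := hf
    simpa only [fourierTransform_torusChar, torusCharBounded_apply] using h ℓ
  | zero => simpa using tendsto_const_nhds
  | add f g _ _ hf hg =>
    simp only [BoundedContinuousFunction.add_apply]
    simp_rw [fun i => integral_add (f.integrable (μ i : Measure Circle)) (g.integrable _),
      integral_add (f.integrable (μ₀ : Measure Circle)) (g.integrable _)]
    exact hf.add hg
  | smul c f _ hf =>
    simp only [BoundedContinuousFunction.smul_apply, integral_smul]
    exact hf.const_smul c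

/-- Lévy's continuity theorem on the torus. Tightness is automatic, by compactness. -/
theorem tendsto_of_tendsto_fourierTransform {ι : Type*} {F : Filter ι}
    {μ : ι → ProbabilityMeasure Circle} {μ₀ : ProbabilityMeasure Circle}
    (h : ∀ ℓ : ℤ, Tendsto (fun i => fourierTransform (μ i : Measure Circle) (torusChar ℓ)) F
      (𝓝 (fourierTransform (μ₀ : Measure Circle) (torusChar ℓ)))) :
    Tendsto μ F (𝓝 μ₀) := by
  refine ProbabilityMeasure.tendsto_of_tight_of_separatesPoints ℂ ?_ (A := trigPolynomials) ?_
    fun g hg => tendsto_integral_trigPolynomial h hg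
  · exact IsTightMeasureSet.of_compactSpace
  · intro x y hxy
    refine ⟨fun y : Circle => (y : ℂ), ⟨⟨_, continuous_subtype_val⟩, ⟨torusCharBounded 1,
      Algebra.subset_adjoin ⟨1, rfl⟩, ?_⟩, rfl⟩, fun h => hxy (Circle.coe_injective h)⟩
    ext y
    simp
    rfl

/-- A probability measure on the torus is determined by its Fourier coefficients. -/
theorem eq_of_fourierTransform_eq {μ ν : ProbabilityMeasure Circle}
    (h : ∀ ℓ : ℤ, fourierTransform (μ : Measure Circle) (torusChar ℓ) =
      fourierTransform (ν : Measure Circle) (torusChar ℓ)) : μ = ν := by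
  have key : Tendsto (fun _ : ℕ => μ) atTop (𝓝 ν) :=
    tendsto_of_tendsto_fourierTransform fun ℓ => by
      rw [h ℓ]
      exact tendsto_const_nhds
  exact tendsto_nhds_unique tendsto_const_nhds key

/-- A pointwise limit of Fourier transforms of probability measures on the torus is itself such a
Fourier transform: the space of probability measures on the torus is compact. -/
theorem exists_fourierTransform_eq_of_tendsto {μ : ℕ → ProbabilityMeasure Circle} {c : ℤ → ℂ}
    (h : ∀ ℓ : ℤ, Tendsto (fun n => fourierTransform (μ n : Measure Circle) (torusChar ℓ)) atTop
      (𝓝 (c ℓ))) :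
    ∃ ρ : ProbabilityMeasure Circle,
      ∀ ℓ : ℤ, fourierTransform (ρ : Measure Circle) (torusChar ℓ) = c ℓ := by
  obtain ⟨ρ, -, hρ⟩ := isCompact_univ.ultrafilter_le_nhds ((hyperfilter ℕ).map μ) (by simp)
  refine ⟨ρ, fun ℓ => tendsto_nhds_unique ?_ ((h ℓ).mono_left Nat.hyperfilter_le_atTop)⟩
  have hρ' : Tendsto μ (hyperfilter ℕ : Filter ℕ) (𝓝 ρ) := hρ
  rw [ProbabilityMeasure.tendsto_iff_forall_integral_rclike_tendsto ℂ] at hρ'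
  simpa only [fourierTransform_torusChar] using! hρ' (torusCharBounded ℓ)

theorem fourierTransform_mconv (μ ν : Measure Circle) [IsFiniteMeasure μ] [IsFiniteMeasure ν]
    (ℓ : ℤ) : fourierTransform (μ ∗ₘ ν) (torusChar ℓ) =
      fourierTransform μ (torusChar ℓ) * fourierTransform ν (torusChar ℓ) := by
  simp_rw [fourierTransform_torusChar]
  rw [integral_mconv (integrable_coe_zpow _ ℓ)]
  simp_rw [Circle.coe_mul, mul_zpow, integral_const_mul, integral_mul_const]

theorem fourierTransform_dirac (a : Circle) (ℓ : ℤ) :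
    fourierTransform (Measure.dirac a) (torusChar ℓ) = (a : ℂ) ^ ℓ := by
  rw [fourierTransform_torusChar, integral_dirac]

/-! ### The local logarithm of the torus -/

theorem circleExp_torusArg (y : Circle) : Circle.exp (torusArg y) = y := by
  by_cases h : Complex.arg (y : ℂ) = Real.pi
  · rw [torusArg, if_pos h, Circle.exp_neg, ← Circle.exp_arg y, h]
    ext
    simp
  · rw [torusArg, if_neg h, Circle.exp_arg]

theorem torusArg_mem_Ico (y : Circle) : torusArg y ∈ Set.Ico (-Real.pi) Real.pi := by
  by_cases h : Complex.arg (y : ℂ) = Real.pi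
  · rw [torusArg, if_pos h]
    exact ⟨le_rfl, by linarith [Real.pi_pos]⟩
  · rw [torusArg, if_neg h]
    exact ⟨(Complex.neg_pi_lt_arg _).le, lt_of_le_of_ne (Complex.arg_le_pi _) h⟩

/-- The truncated argument `y ↦ h(arg y)`, a continuous map which inverts `Circle.exp` near the
identity. -/
noncomputable def localLog (y : Circle) : ℝ := torusTrunc (torusArg y)

/-- Since `h(x) = arcsin (sin x)` on `[-π, π)`, the map `localLog` is continuous. -/
theorem localLog_eq_arcsin (y : Circle) : localLog y = Real.arcsin (y : ℂ).im := by
  obtain ⟨h₁, h₂⟩ := torusArg_mem_Ico y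
  have him : (y : ℂ).im = Real.sin (torusArg y) := by
    conv_lhs => rw [← circleExp_torusArg y, Circle.coe_exp, Complex.exp_ofReal_mul_I_im]
  rw [him, localLog]
  set x := torusArg y
  rw [torusTrunc, if_neg (by simp only [not_or, not_lt, not_le]; exact ⟨h₁, h₂⟩)]
  split_ifs with h₃ h₄
  · rw [← Real.arcsin_sin (x := -x - Real.pi) (by linarith) (by linarith), Real.sin_sub_pi,
      Real.sin_neg, neg_neg]
  · rw [Real.arcsin_sin (by linarith) (by linarith)]
  · rw [← Real.arcsin_sin (x := -x + Real.pi) (by linarith) (by linarith), neg_add_eq_sub,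
      Real.sin_pi_sub]

@[fun_prop]
theorem continuous_localLog : Continuous localLog := by
  rw [funext localLog_eq_arcsin]
  exact Real.continuous_arcsin.comp (Complex.continuous_im.comp continuous_subtype_val)

theorem localLog_one : localLog 1 = 0 := by simp [localLog_eq_arcsin]

theorem abs_localLog_le (y : Circle) : |localLog y| ≤ 2 := by
  rw [localLog_eq_arcsin, abs_le]
  constructor <;> linarith [Real.arcsin_le_pi_div_two (y : ℂ).im,
    Real.neg_pi_div_two_le_arcsin (y : ℂ).im, Real.pi_lt_four]

theorem circleExp_localLog {y : Circle} (hy : 0 ≤ (y : ℂ).re) : Circle.exp (localLog y) = y := by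
  have : Complex.arg (y : ℂ) = localLog y := by
    rw [Complex.arg_of_re_nonneg hy, Circle.norm_coe, div_one, localLog_eq_arcsin]
  rw [← this, Circle.exp_arg]

theorem abs_re_le_one (y : Circle) : |(y : ℂ).re| ≤ 1 :=
  (Complex.abs_re_le_norm _).trans_eq (Circle.norm_coe y)

/-- The square of the local logarithm is controlled by the integrand of the Lévy condition for the
character `y ↦ y`. -/
theorem localLog_sq_le (y : Circle) : localLog y ^ 2 ≤ 8 * (1 - (y : ℂ).re) := by
  have hre := abs_le.1 (abs_re_le_one y)
  have hnorm : (y : ℂ).re ^ 2 + (y : ℂ).im ^ 2 = 1 := by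
    have := Complex.normSq_apply (y : ℂ)
    rw [Circle.normSq_coe] at this
    nlinarith
  have him : (y : ℂ).im = Real.sin (localLog y) := by
    rw [localLog_eq_arcsin, Real.sin_arcsin] <;> nlinarith
  have habs : 2 / Real.pi * |localLog y| ≤ |(y : ℂ).im| := by
    rw [him]
    refine Real.mul_abs_le_abs_sin ?_
    rw [localLog_eq_arcsin, abs_le]
    exact ⟨Real.neg_pi_div_two_le_arcsin _, Real.arcsin_le_pi_div_two _⟩
  have hpi : 1 / 2 ≤ 2 / Real.pi := by
    rw [div_le_div_iff₀ two_pos Real.pi_pos]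
    linarith [Real.pi_lt_four]
  have h2 : 1 / 2 * |localLog y| ≤ |(y : ℂ).im| :=
    (mul_le_mul_of_nonneg_right hpi (abs_nonneg _)).trans habs
  have h3 : (1 / 2 * |localLog y|) ^ 2 ≤ |(y : ℂ).im| ^ 2 := by gcongr
  rw [mul_pow, sq_abs, sq_abs] at h3
  nlinarith

/-- The error of replacing `y` by the exponential of its local logarithm in the character
`y ↦ y ^ ℓ`. -/
noncomputable def farPart (ℓ : ℤ) (y : Circle) : ℂ :=
  (y : ℂ) ^ ℓ - Complex.exp ((ℓ * localLog y : ℝ) * Complex.I)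

@[fun_prop]
theorem continuous_farPart (ℓ : ℤ) : Continuous (farPart ℓ) := by
  have := continuous_coe_zpow ℓ
  unfold farPart
  fun_prop

theorem farPart_eq_zero (ℓ : ℤ) {y : Circle} (hy : 0 ≤ (y : ℂ).re) : farPart ℓ y = 0 := by
  rw [farPart, sub_eq_zero]
  conv_lhs => rw [← circleExp_localLog hy, Circle.coe_exp, ← Complex.exp_int_mul]
  push_cast
  ring_nf

theorem norm_farPart_le_two (ℓ : ℤ) (y : Circle) : ‖farPart ℓ y‖ ≤ 2 := by
  refine (norm_sub_le _ _).trans ?_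
  rw [Complex.norm_exp_ofReal_mul_I, norm_zpow, Circle.norm_coe, one_zpow]
  norm_num

theorem norm_farPart_le (ℓ : ℤ) (y : Circle) : ‖farPart ℓ y‖ ≤ 2 * (1 - (y : ℂ).re) := by
  rcases le_or_gt 0 (y : ℂ).re with hy | hy
  · rw [farPart_eq_zero ℓ hy, norm_zero]
    linarith [(abs_le.1 (abs_re_le_one y)).2]
  · linarith [norm_farPart_le_two ℓ y]

theorem farPart_eventually_eq_zero (ℓ : ℤ) : ∀ᶠ y in 𝓝 (1 : Circle), farPart ℓ y = 0 := by
  have h : Continuous fun y : Circle => (y : ℂ).re :=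
    Complex.continuous_re.comp continuous_subtype_val
  filter_upwards [(isOpen_lt continuous_const h).mem_nhds
    (show (0 : ℝ) < ((1 : Circle) : ℂ).re by simp)] with y hy
  exact farPart_eq_zero ℓ (le_of_lt hy)

/-! ### The second-order remainder of the exponential -/

/-- The second-order Taylor remainder of `s ↦ exp (i s)` at `0`. -/
noncomputable def expRemainder (s : ℝ) : ℂ :=
  Complex.exp (s * Complex.I) - 1 - s * Complex.I + (s : ℂ) ^ 2 / 2

@[fun_prop]
theorem continuous_expRemainder : Continuous expRemainder := by
  unfold expRemainder
  fun_prop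

theorem norm_exp_sub_exp_le (s t : ℝ) :
    ‖Complex.exp (s * Complex.I) - Complex.exp (t * Complex.I)‖ ≤ |s - t| := by
  have h : Complex.exp (s * Complex.I) - Complex.exp (t * Complex.I) =
      Complex.exp (t * Complex.I) * (Complex.exp (Complex.I * (s - t : ℝ)) - 1) := by
    rw [mul_sub, ← Complex.exp_add, mul_one]
    push_cast
    ring_nf
  rw [h, norm_mul, Complex.norm_exp_ofReal_mul_I, one_mul]
  exact Real.norm_exp_I_mul_ofReal_sub_one_le

theorem norm_expRemainder_sub_le (s t : ℝ) :
    ‖expRemainder s - expRemainder t‖ ≤ |s - t| * (2 + |s| + |t|) := by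
  have h : expRemainder s - expRemainder t =
      (Complex.exp (s * Complex.I) - Complex.exp (t * Complex.I)) - (s - t : ℝ) * Complex.I +
        ((s - t) * (s + t) / 2 : ℝ) := by
    simp only [expRemainder]
    push_cast
    ring
  rw [h]
  refine (norm_add_le _ _).trans ((add_le_add (norm_sub_le _ _) le_rfl).trans ?_)
  rw [norm_mul, Complex.norm_I, Complex.norm_real, Complex.norm_real, Real.norm_eq_abs,
    Real.norm_eq_abs, abs_div, abs_mul, abs_two]
  have := norm_exp_sub_exp_le s t
  nlinarith [abs_nonneg (s - t), abs_add_le s t, abs_nonneg s, abs_nonneg t,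
    mul_le_mul_of_nonneg_left (abs_add_le s t) (abs_nonneg (s - t)),
    mul_nonneg (abs_nonneg (s - t)) (abs_nonneg s), mul_nonneg (abs_nonneg (s - t)) (abs_nonneg t)]

theorem norm_expRemainder_le_sq (s : ℝ) : ‖expRemainder s‖ ≤ 3 * s ^ 2 := by
  have hsq : ‖(s : ℂ) ^ 2 / 2‖ = s ^ 2 / 2 := by simp
  refine (norm_add_le _ _).trans ?_
  rw [hsq]
  suffices ‖Complex.exp (s * Complex.I) - 1 - s * Complex.I‖ ≤ 2 * s ^ 2 by nlinarith
  have hn : ‖(s : ℂ) * Complex.I‖ = |s| := by simp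
  rcases le_total |s| 1 with h | h
  · refine (Complex.norm_exp_sub_one_sub_id_le (by rwa [hn])).trans ?_
    rw [hn, sq_abs]
    nlinarith
  · refine (norm_sub_le _ _).trans ?_
    have := norm_exp_sub_exp_le s 0
    simp only [Complex.ofReal_zero, zero_mul, Complex.exp_zero, sub_zero] at this
    rw [hn, ← sq_abs]
    nlinarith

theorem norm_expRemainder_le_cube (s : ℝ) : ‖expRemainder s‖ ≤ 3 * |s| ^ 3 := by
  rcases le_total |s| 1 with h | h
  · have hn : ‖(s : ℂ) * Complex.I‖ = |s| := by simp
    have := Complex.exp_bound (x := s * Complex.I) (by rwa [hn]) (n := 3) (by norm_num)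
    rw [hn] at this
    have heq : Complex.exp (s * Complex.I) -
        ∑ m ∈ Finset.range 3, ((s : ℂ) * Complex.I) ^ m / (m.factorial : ℂ) = expRemainder s := by
      simp only [Finset.sum_range_succ, Finset.sum_range_zero, expRemainder, Nat.factorial,
        mul_pow, Complex.I_sq]
      push_cast
      ring
    rw [heq] at this
    refine this.trans ?_
    rw [mul_comm]
    gcongr
    norm_num [Nat.factorial]
  · refine (norm_expRemainder_le_sq s).trans ?_
    rw [← sq_abs]
    nlinarith [sq_nonneg |s|]

/-! ### Integrability with respect to a Lévy measure -/

namespace IsLevyMeasure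

variable {η : Measure Circle}

theorem integrable_one_sub_re (hη : IsLevyMeasure η) :
    Integrable (fun y : Circle => 1 - (y : ℂ).re) η := by
  have hc : Continuous fun y : Circle => 1 - (y : ℂ).re :=
    continuous_const.sub (Complex.continuous_re.comp continuous_subtype_val)
  refine ⟨hc.aestronglyMeasurable, ?_⟩
  rw [hasFiniteIntegral_iff_ofReal
    (ae_of_all _ fun y => by simpa using (abs_le.1 (abs_re_le_one y)).2)]
  simpa [coe_torusChar] using hη.lintegral_lt_top (torusChar 1)

theorem integrable_localLog_sq (hη : IsLevyMeasure η) :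
    Integrable (fun y => localLog y ^ 2) η := by
  refine (hη.integrable_one_sub_re.const_mul 8).mono'
    (continuous_localLog.pow 2).aestronglyMeasurable (ae_of_all _ fun y => ?_)
  rw [Real.norm_of_nonneg (sq_nonneg _)]
  exact localLog_sq_le y

theorem integrable_farPart (hη : IsLevyMeasure η) (ℓ : ℤ) : Integrable (farPart ℓ) η :=
  (hη.integrable_one_sub_re.const_mul 2).mono' (continuous_farPart ℓ).aestronglyMeasurable
    (ae_of_all _ (norm_farPart_le ℓ))

theorem integrable_expRemainder (hη : IsLevyMeasure η) (ℓ : ℤ) :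
    Integrable (fun y => expRemainder (ℓ * localLog y)) η := by
  refine (hη.integrable_localLog_sq.const_mul (3 * (ℓ : ℝ) ^ 2)).mono'
    (by fun_prop : Continuous fun y => expRemainder (ℓ * localLog y)).aestronglyMeasurable
    (ae_of_all _ fun y => ?_)
  exact (norm_expRemainder_le_sq _).trans_eq (by ring)

/-- A continuous function on the torus that vanishes near the identity is integrable. -/
theorem integrable_of_eventually_eq_zero {E : Type*} [NormedAddCommGroup E]
    [SecondCountableTopologyEither Circle E] (hη : IsLevyMeasure η) {f : Circle → E}
    (hf : Continuous f) (hf0 : ∀ᶠ y in 𝓝 (1 : Circle), f y = 0) : Integrable f η := by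
  obtain ⟨U, hU, hUo, hU1⟩ := eventually_nhds_iff.1 hf0
  obtain ⟨C, hC⟩ := (isCompact_range hf).isBounded.exists_norm_le
  have hfin : η Uᶜ < ⊤ := hη.measure_compl_lt_top U (hUo.mem_nhds hU1) hUo.measurableSet
  have hon : IntegrableOn f Uᶜ η :=
    Measure.integrableOn_of_bounded (M := C) hfin.ne hf.aestronglyMeasurable
      (ae_of_all _ fun y => hC _ ⟨y, rfl⟩)
  rw [integrableOn_iff_integrable_of_support_subset] at hon
  · exact hon
  · intro y hy hyU
    exact hy (hU y hyU)

end IsLevyMeasure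

/-- The integrand of the generalized Poisson exponent, split into the second-order remainder, the
quadratic term and a part vanishing near the identity. -/
theorem torusExponent_eq (ℓ : ℤ) (y : Circle) :
    ((torusChar ℓ y : Circle) : ℂ) - 1 - Complex.I * (torusInner y ℓ : ℂ) =
      expRemainder (ℓ * localLog y) - ((ℓ : ℝ) ^ 2 / 2 * localLog y ^ 2 : ℝ) + farPart ℓ y := by
  have h : torusInner y ℓ = ℓ * localLog y := rfl
  rw [coe_torusChar, h, expRemainder, farPart]
  push_cast
  ring

theorem IsLevyMeasure.integrable_torusExponent {η : Measure Circle} (hη : IsLevyMeasure η)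
    (ℓ : ℤ) : Integrable (fun y : Circle =>
      ((torusChar ℓ y : Circle) : ℂ) - 1 - Complex.I * (torusInner y ℓ : ℂ)) η := by
  simp_rw [torusExponent_eq]
  exact ((hη.integrable_expRemainder ℓ).sub
    (hη.integrable_localLog_sq.const_mul ((ℓ : ℝ) ^ 2 / 2)).ofReal).add (hη.integrable_farPart ℓ)

theorem IsLevyMeasure.integral_torusExponent {η : Measure Circle} (hη : IsLevyMeasure η)
    (ℓ : ℤ) : ∫ y : Circle,
      (((torusChar ℓ y : Circle) : ℂ) - 1 - Complex.I * (torusInner y ℓ : ℂ)) ∂η =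
      ∫ y, expRemainder (ℓ * localLog y) ∂η - ((ℓ : ℝ) ^ 2 / 2 * ∫ y, localLog y ^ 2 ∂η : ℝ) +
        ∫ y, farPart ℓ y ∂η := by
  simp_rw [torusExponent_eq]
  have hq := (hη.integrable_localLog_sq.const_mul ((ℓ : ℝ) ^ 2 / 2)).ofReal (𝕜 := ℂ)
  refine (integral_add ((hη.integrable_expRemainder ℓ).sub hq) (hη.integrable_farPart ℓ)).trans ?_
  congr 1
  refine (integral_sub (hη.integrable_expRemainder ℓ) hq).trans ?_
  rw [← integral_const_mul]
  congr 1
  exact integral_ofReal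

/-! ### Gauss measures and generalized Poisson measures -/

/-- The symmetric Gauss measure of the torus is the wrapped normal distribution. -/
theorem exists_isTorusGauss {b : ℝ} (hb : 0 ≤ b) :
    ∃ γ : ProbabilityMeasure Circle, IsTorusGauss b γ := by
  lift b to NNReal using hb
  refine ⟨⟨(gaussianReal 0 b).map Circle.exp,
    Measure.isProbabilityMeasure_map (by fun_prop)⟩, fun ℓ => ?_⟩
  rw [fourierTransform_torusChar, ProbabilityMeasure.coe_mk,
    integral_map (by fun_prop) (continuous_coe_zpow ℓ).aestronglyMeasurable]
  have h := charFun_gaussianReal (μ := 0) (v := b) (ℓ : ℝ)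
  rw [charFun_apply_real] at h
  have hexp : ∀ x : ℝ, (Circle.exp x : ℂ) ^ ℓ = Complex.exp ((ℓ : ℝ) * x * Complex.I) := fun x => by
    rw [Circle.coe_exp, ← Complex.exp_int_mul]
    push_cast
    ring_nf
  simp_rw [hexp]
  rw [h, torusQuadraticForm]
  congr 1
  push_cast
  ring

/-- Convolution powers of a probability measure. -/
theorem exists_fourierTransform_eq_pow (μ : ProbabilityMeasure Circle) (n : ℕ) :
    ∃ ρ : ProbabilityMeasure Circle, ∀ ℓ : ℤ, fourierTransform (ρ : Measure Circle) (torusChar ℓ) =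
      fourierTransform (μ : Measure Circle) (torusChar ℓ) ^ n := by
  induction n with
  | zero =>
    refine ⟨⟨Measure.dirac 1, inferInstance⟩, fun ℓ => ?_⟩
    rw [ProbabilityMeasure.coe_mk, fourierTransform_dirac]
    simp
  | succ n ih =>
    obtain ⟨ρ, hρ⟩ := ih
    refine ⟨⟨(ρ : Measure Circle) ∗ₘ (μ : Measure Circle), inferInstance⟩, fun ℓ => ?_⟩
    rw [ProbabilityMeasure.coe_mk, fourierTransform_mconv, hρ, pow_succ]

/-- The mixture of a point mass at the identity with a small multiple of a finite measure. -/
theorem exists_fourierTransform_eq_one_add (ν : Measure Circle) [IsFiniteMeasure ν] {N : ℝ}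
    (hN : 0 < N) (hν : ν.real Set.univ ≤ N) :
    ∃ ρ : ProbabilityMeasure Circle, ∀ ℓ : ℤ, fourierTransform (ρ : Measure Circle) (torusChar ℓ) =
      1 + (∫ y : Circle, ((y : ℂ) ^ ℓ - 1) ∂ν) / N := by
  have h₀ : 0 ≤ 1 - ν.real Set.univ / N := by
    rw [sub_nonneg, div_le_one hN]
    exact hν
  have hprob : IsProbabilityMeasure (ENNReal.ofReal (1 - ν.real Set.univ / N) •
      Measure.dirac (1 : Circle) + ENNReal.ofReal (1 / N) • ν) := by
    constructor
    rw [Measure.add_apply, Measure.smul_apply, Measure.smul_apply, measure_univ, smul_eq_mul,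
      smul_eq_mul, mul_one, ← ofReal_measureReal (μ := ν), ← ENNReal.ofReal_mul (by positivity),
      ← ENNReal.ofReal_add h₀ (by positivity)]
    simp only [ENNReal.ofReal_eq_one]
    ring
  refine ⟨⟨_, hprob⟩, fun ℓ => ?_⟩
  rw [fourierTransform_torusChar, ProbabilityMeasure.coe_mk, integral_add_measure
    ((integrable_coe_zpow _ ℓ).smul_measure (by simp)) ((integrable_coe_zpow _ ℓ).smul_measure
    (by simp)), integral_smul_measure, integral_smul_measure, integral_dirac,
    integral_sub (integrable_coe_zpow ν ℓ) (integrable_const _), integral_const,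
    ENNReal.toReal_ofReal h₀, ENNReal.toReal_ofReal (by positivity)]
  simp only [Circle.coe_one, one_zpow, Complex.real_smul]
  push_cast
  ring

/-- Compound Poisson measures exist, as limits of the binomial-type convolution powers with Fourier
transform `(1 + ∫ (χ - 1) dν / N) ^ N`. -/
theorem exists_compoundPoisson (ν : Measure Circle) [IsFiniteMeasure ν] :
    ∃ ρ : ProbabilityMeasure Circle, ∀ ℓ : ℤ, fourierTransform (ρ : Measure Circle) (torusChar ℓ) =
      Complex.exp (∫ y : Circle, ((y : ℂ) ^ ℓ - 1) ∂ν) := by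
  set N : ℕ → ℕ := fun n => n + (⌈ν.real Set.univ⌉₊ + 1) with hNdef
  have hN : ∀ n, ∃ ρ : ProbabilityMeasure Circle, ∀ ℓ : ℤ,
      fourierTransform (ρ : Measure Circle) (torusChar ℓ) =
        (1 + (∫ y : Circle, ((y : ℂ) ^ ℓ - 1) ∂ν) / (N n : ℂ)) ^ N n := by
    intro n
    have hle : ν.real Set.univ ≤ (N n : ℝ) := by
      refine (Nat.le_ceil _).trans ?_
      exact_mod_cast (by omega : ⌈ν.real Set.univ⌉₊ ≤ n + (⌈ν.real Set.univ⌉₊ + 1))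
    have hpos : (0 : ℝ) < N n := by
      exact_mod_cast (by omega : 0 < n + (⌈ν.real Set.univ⌉₊ + 1))
    obtain ⟨μ, hμ⟩ := exists_fourierTransform_eq_one_add ν hpos hle
    obtain ⟨ρ, hρ⟩ := exists_fourierTransform_eq_pow μ (N n)
    refine ⟨ρ, fun ℓ => ?_⟩
    rw [hρ, hμ]
    norm_cast
  choose ρ hρ using hN
  refine exists_fourierTransform_eq_of_tendsto (μ := ρ) fun ℓ => ?_
  simp_rw [hρ]
  exact (Complex.tendsto_one_add_div_pow_exp _).comp (tendsto_add_atTop_nat _)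

/-- For a finite measure the centring integral converges, so that the generalized Poisson measure is
a translate of the compound Poisson measure. -/
theorem exists_isTorusGeneralizedPoisson_of_isFiniteMeasure (ν : Measure Circle)
    [IsFiniteMeasure ν] : ∃ ρ : ProbabilityMeasure Circle,
      ∀ ℓ : ℤ, fourierTransform (ρ : Measure Circle) (torusChar ℓ) =
        Complex.exp (∫ y : Circle,
          (((torusChar ℓ y : Circle) : ℂ) - 1 - Complex.I * (torusInner y ℓ : ℂ)) ∂ν) := by
  obtain ⟨ρ, hρ⟩ := exists_compoundPoisson ν
  refine ⟨⟨Measure.dirac (Circle.exp (-∫ y, localLog y ∂ν)) ∗ₘ (ρ : Measure Circle),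
    inferInstance⟩, fun ℓ => ?_⟩
  have hlog : Integrable localLog ν :=
    .of_bound continuous_localLog.aestronglyMeasurable 2 (ae_of_all _ abs_localLog_le)
  have hcalc : ∫ y : Circle,
      (((torusChar ℓ y : Circle) : ℂ) - 1 - Complex.I * (torusInner y ℓ : ℂ)) ∂ν =
        ∫ y : Circle, ((y : ℂ) ^ ℓ - 1) ∂ν - Complex.I * ℓ * (∫ y, localLog y ∂ν : ℝ) := by
    have hint : Integrable (fun y => Complex.I * (torusInner y ℓ : ℂ)) ν :=
      ((hlog.const_mul (ℓ : ℝ)).ofReal (𝕜 := ℂ)).const_mul Complex.I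
    simp_rw [coe_torusChar]
    refine (integral_sub ((integrable_coe_zpow ν ℓ).sub (integrable_const 1)) hint).trans ?_
    congr 1
    rw [← integral_complex_ofReal, ← integral_const_mul (Complex.I * ℓ)]
    refine integral_congr_ae (ae_of_all _ fun y => ?_)
    simp [torusInner, localLog, mul_assoc]
  rw [ProbabilityMeasure.coe_mk, fourierTransform_mconv, fourierTransform_dirac, hρ, hcalc,
    Circle.coe_exp, ← Complex.exp_int_mul, ← Complex.exp_add]
  congr 1
  push_cast
  ring

/-- The generalized Poisson measure of a Lévy measure `η` is the limit of those of the restrictions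
of `η` to the sets `{y | 1 / (n + 1) ≤ 1 - Re y}`, which have finite measure. -/
theorem exists_isTorusGeneralizedPoisson {η : Measure Circle} (hη : IsLevyMeasure η) :
    ∃ ρ : ProbabilityMeasure Circle, IsTorusGeneralizedPoisson η ρ := by
  set S : ℕ → Set Circle := fun n => {y | 1 / ((n : ℝ) + 1) ≤ 1 - (y : ℂ).re} with hS
  have hre : Continuous fun y : Circle => 1 - (y : ℂ).re :=
    continuous_const.sub (Complex.continuous_re.comp continuous_subtype_val)
  have hSc : ∀ n, IsClosed (S n) := fun n => isClosed_le continuous_const hre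
  have hfin : ∀ n, IsFiniteMeasure (η.restrict (S n)) := by
    intro n
    have h1 : (S n)ᶜ ∈ 𝓝 (1 : Circle) := by
      refine (hSc n).isOpen_compl.mem_nhds ?_
      simp only [hS, Set.mem_compl_iff, Set.mem_ofPred_eq, Circle.coe_one, Complex.one_re, sub_self,
        not_le]
      positivity
    refine ⟨?_⟩
    rw [Measure.restrict_apply_univ]
    simpa using hη.measure_compl_lt_top _ h1 (hSc n).measurableSet.compl
  have hmono : Monotone S := by
    intro m n hmn y hy
    refine le_trans ?_ (show 1 / ((m : ℝ) + 1) ≤ 1 - (y : ℂ).re from hy)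
    gcongr
  have hunion : ∀ᵐ y ∂η, y ∈ ⋃ n, S n := by
    have h1 : ∀ᵐ y ∂η, y ≠ 1 := by
      rw [ae_iff]
      simpa using hη.measure_one
    filter_upwards [h1] with y hy
    have hpos : 0 < 1 - (y : ℂ).re := by
      refine lt_of_le_of_ne (by linarith [(abs_le.1 (abs_re_le_one y)).2]) fun h => hy ?_
      have hsq := Complex.normSq_apply (y : ℂ)
      rw [Circle.normSq_coe] at hsq
      have hr : (y : ℂ).re = 1 := by linarith
      have hi : (y : ℂ).im = 0 := by
        rw [hr] at hsq
        nlinarith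
      ext
      exact Complex.ext (by simpa using hr) (by simpa using hi)
    obtain ⟨n, hn⟩ := exists_nat_one_div_lt hpos
    exact Set.mem_iUnion.2 ⟨n, hn.le⟩
  choose ρ hρ using fun n => exists_isTorusGeneralizedPoisson_of_isFiniteMeasure (η.restrict (S n))
  obtain ⟨ρ', hρ'⟩ := exists_fourierTransform_eq_of_tendsto (μ := ρ)
    (c := fun ℓ => Complex.exp (∫ y : Circle,
      (((torusChar ℓ y : Circle) : ℂ) - 1 - Complex.I * (torusInner y ℓ : ℂ)) ∂η)) fun ℓ => by
    simp_rw [hρ]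
    refine (Complex.continuous_exp.tendsto _).comp ?_
    have := tendsto_setIntegral_of_monotone (fun n => (hSc n).measurableSet) hmono
      (hη.integrable_torusExponent ℓ).integrableOn
    rwa [Measure.restrict_eq_self_of_ae_mem hunion] at this
  exact ⟨ρ', fun ℓ => ⟨hη.integrable_torusExponent ℓ, hρ' ℓ⟩⟩

theorem existsUnique_isTorusGauss {b : ℝ} (hb : 0 ≤ b) :
    ∃! γ : ProbabilityMeasure Circle, IsTorusGauss b γ := by
  obtain ⟨γ, hγ⟩ := exists_isTorusGauss hb
  exact ⟨γ, hγ, fun γ' hγ' => eq_of_fourierTransform_eq fun ℓ => (hγ' ℓ).trans (hγ ℓ).symm⟩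

theorem existsUnique_isTorusGeneralizedPoisson {η : Measure Circle} (hη : IsLevyMeasure η) :
    ∃! ρ : ProbabilityMeasure Circle, IsTorusGeneralizedPoisson η ρ := by
  obtain ⟨ρ, hρ⟩ := exists_isTorusGeneralizedPoisson hη
  exact ⟨ρ, hρ, fun ρ' hρ' =>
    eq_of_fourierTransform_eq fun ℓ => (hρ' ℓ).2.trans (hρ ℓ).2.symm⟩

/-! ### Products of perturbations of one -/

theorem norm_prod_sub_prod_le_sum {ι : Type*} (s : Finset ι) {u v : ι → ℂ}
    (hu : ∀ i, ‖u i‖ ≤ 1) (hv : ∀ i, ‖v i‖ ≤ 1) :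
    ‖∏ i ∈ s, u i - ∏ i ∈ s, v i‖ ≤ ∑ i ∈ s, ‖u i - v i‖ := by
  classical
  induction s using Finset.induction_on with
  | empty => simp
  | insert i s hi ih =>
    rw [Finset.prod_insert hi, Finset.prod_insert hi, Finset.sum_insert hi]
    have hprod : ‖∏ j ∈ s, u j‖ ≤ 1 := by
      rw [norm_prod]
      exact Finset.prod_le_one (fun _ _ => norm_nonneg _) fun j _ => hu j
    calc ‖u i * ∏ j ∈ s, u j - v i * ∏ j ∈ s, v j‖
        = ‖(u i - v i) * ∏ j ∈ s, u j + v i * (∏ j ∈ s, u j - ∏ j ∈ s, v j)‖ := by ring_nf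
      _ ≤ ‖u i - v i‖ * 1 + 1 * ∑ j ∈ s, ‖u j - v j‖ := by
        refine (norm_add_le _ _).trans ?_
        rw [norm_mul, norm_mul]
        gcongr
        exact hv i
      _ = _ := by ring

/-- If the perturbations `z` are uniformly small, have bounded absolute row sums and keep `1 + z` in
the unit disc, then products of the factors `1 + z` converge whenever the sums of `z` do. -/
theorem tendsto_prod_one_add {K : ℕ → ℕ} {z : (n : ℕ) → Fin (K n) → ℂ} {L : ℂ} {C : ℝ}
    (hz1 : ∀ n k, ‖1 + z n k‖ ≤ 1) (hsmall : ∀ ε > 0, ∀ᶠ n in atTop, ∀ k, ‖z n k‖ ≤ ε)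
    (hbdd : ∀ᶠ n in atTop, ∑ k, ‖z n k‖ ≤ C)
    (hsum : Tendsto (fun n => ∑ k, z n k) atTop (𝓝 L)) :
    Tendsto (fun n => ∏ k, (1 + z n k)) atTop (𝓝 (Complex.exp L)) := by
  have hexp : Tendsto (fun n => ∏ k, Complex.exp (z n k)) atTop (𝓝 (Complex.exp L)) := by
    simp_rw [← Complex.exp_sum]
    exact (Complex.continuous_exp.tendsto L).comp hsum
  -- `1 + z` lies in the unit disc, so `Re z ≤ 0` and `exp z` lies there too.
  have hexp1 : ∀ n k, ‖Complex.exp (z n k)‖ ≤ 1 := fun n k => by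
    rw [Complex.norm_exp, Real.exp_le_one_iff]
    have h := (Complex.re_le_norm (1 + z n k)).trans (hz1 n k)
    simp only [Complex.add_re, Complex.one_re] at h
    linarith
  have hdiff : Tendsto (fun n => ∏ k, (1 + z n k) - ∏ k, Complex.exp (z n k)) atTop (𝓝 0) := by
    rw [NormedAddGroup.tendsto_nhds_zero]
    intro ε hε
    have hC : 0 < |C| + 1 := by positivity
    filter_upwards [hsmall (min 1 (ε / 2 / (|C| + 1))) (by positivity), hbdd] with n hn hnC
    have hterm : ∀ k, ‖1 + z n k - Complex.exp (z n k)‖ ≤ ε / 2 / (|C| + 1) * ‖z n k‖ := by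
      intro k
      have h := Complex.norm_exp_sub_one_sub_id_le ((hn k).trans (min_le_left _ _))
      rw [← norm_neg] at h
      calc ‖1 + z n k - Complex.exp (z n k)‖ = ‖-(Complex.exp (z n k) - 1 - z n k)‖ := by ring_nf
        _ ≤ ‖z n k‖ * ‖z n k‖ := h.trans_eq (sq _)
        _ ≤ _ := by
          gcongr
          exact (hn k).trans (min_le_right _ _)
    calc ‖∏ k, (1 + z n k) - ∏ k, Complex.exp (z n k)‖
        ≤ ∑ k, ‖1 + z n k - Complex.exp (z n k)‖ :=
          norm_prod_sub_prod_le_sum _ (hz1 n) (hexp1 n)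
      _ ≤ ε / 2 / (|C| + 1) * ∑ k, ‖z n k‖ := by
        rw [Finset.mul_sum]
        exact Finset.sum_le_sum fun k _ => hterm k
      _ ≤ ε / 2 / (|C| + 1) * (|C| + 1) := by
        gcongr
        linarith [le_abs_self C]
      _ < ε := by
        rw [div_mul_cancel₀ _ hC.ne']
        linarith
  simpa using hdiff.add hexp

/-- Convergence of approximations up to arbitrarily small errors implies convergence. -/
theorem tendsto_of_forall_approx {u : ℕ → ℂ} {L : ℂ} {C : ℝ}
    (h : ∀ ε > 0, ∃ (v : ℕ → ℂ) (M : ℂ), Tendsto v atTop (𝓝 M) ∧ ‖M - L‖ ≤ C * ε ∧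
      ∀ᶠ n in atTop, ‖u n - v n‖ ≤ C * ε) :
    Tendsto u atTop (𝓝 L) := by
  rw [Metric.tendsto_nhds]
  intro δ hδ
  have hC : 0 < |C| + 1 := by positivity
  have hε : 0 < δ / 4 / (|C| + 1) := by positivity
  have hCε : C * (δ / 4 / (|C| + 1)) ≤ δ / 4 := by
    calc C * (δ / 4 / (|C| + 1)) ≤ (|C| + 1) * (δ / 4 / (|C| + 1)) := by
          gcongr
          linarith [le_abs_self C]
      _ = δ / 4 := mul_div_cancel₀ _ hC.ne'
  obtain ⟨v, M, hv, hM, huv⟩ := h _ hε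
  filter_upwards [huv, Metric.tendsto_nhds.1 hv (δ / 4) (by positivity)] with n h1 h2
  rw [dist_eq_norm] at h2 ⊢
  calc ‖u n - L‖ = ‖(u n - v n) + (v n - M) + (M - L)‖ := by ring_nf
    _ ≤ ‖u n - v n‖ + ‖v n - M‖ + ‖M - L‖ := norm_add₃_le
    _ < δ := by linarith

/-! ### Infinitesimal arrays -/

section Array

variable {K : ℕ → ℕ} {Ω : ℕ → Type*} [∀ n, MeasurableSpace (Ω n)]
  {P : (n : ℕ) → Measure (Ω n)} [∀ n, IsProbabilityMeasure (P n)]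
  {X : (n : ℕ) → Fin (K n) → Ω n → Circle}

theorem isInfinitesimal_of_tendsto_torusArg
    (h : ∀ ε : ℝ, 0 < ε →
      Tendsto (fun n => ⨆ k : Fin (K n), (P n).real {ω | ε < |torusArg (X n k ω)|})
        atTop (𝓝 0)) : IsInfinitesimal P X := by
  intro U hU _
  have hexp : Tendsto Circle.exp (𝓝 0) (𝓝 1) := by
    simpa using (Circle.exp.continuous.tendsto 0)
  obtain ⟨δ, hδ, hδU⟩ := Metric.eventually_nhds_iff.1 (hexp.eventually hU)
  refine squeeze_zero (fun n => Real.iSup_nonneg fun k => measureReal_nonneg) (fun n => ?_)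
    (h (δ / 2) (by positivity))
  refine ciSup_mono (Set.finite_range _).bddAbove fun k => measureReal_mono fun ω hω => ?_
  by_contra hle
  refine hω ?_
  rw [← circleExp_torusArg (X n k ω)]
  refine hδU ?_
  rw [Real.dist_eq, sub_zero]
  simp only [Set.mem_ofPred_eq, not_lt] at hle
  linarith

/-- In an infinitesimal array, the means of a continuous function vanishing at the identity are
uniformly small. -/
theorem IsInfinitesimal.eventually_integral_norm_le {E : Type*} [NormedAddCommGroup E]
    (hinf : IsInfinitesimal P X) (hX : ∀ n k, Measurable (X n k)) {F : Circle → E}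
    (hF : Continuous F) (hF1 : F 1 = 0) {ε : ℝ} (hε : 0 < ε) :
    ∀ᶠ n in atTop, ∀ k, ∫ ω, ‖F (X n k ω)‖ ∂(P n) ≤ ε := by
  obtain ⟨C, hC⟩ := (isCompact_range hF).isBounded.exists_norm_le
  have hC0 : 0 ≤ C := (norm_nonneg _).trans (hC (F 1) ⟨1, rfl⟩)
  set U : Set Circle := {y | ‖F y‖ < ε / 2} with hU
  have hUo : IsOpen U := isOpen_lt hF.norm continuous_const
  have h1 : (1 : Circle) ∈ U := by
    simp only [hU, Set.mem_ofPred_eq, hF1, norm_zero]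
    positivity
  have hev := (hinf U (hUo.mem_nhds h1) hUo.measurableSet).eventually
    (gt_mem_nhds (show (0 : ℝ) < ε / 2 / (C + 1) by positivity))
  filter_upwards [hev] with n hn k
  have hk : (P n).real {ω | X n k ω ∉ U} ≤ ε / 2 / (C + 1) :=
    (le_ciSup (f := fun k => (P n).real {ω | X n k ω ∉ U})
      (Set.finite_range _).bddAbove k).trans hn.le
  have hmeas : MeasurableSet {ω | X n k ω ∉ U} := hX n k hUo.measurableSet.compl
  have hle : ∀ ω, ‖F (X n k ω)‖ ≤
      ε / 2 + {ω | X n k ω ∉ U}.indicator (fun _ => C) ω := by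
    intro ω
    by_cases hω : X n k ω ∈ U
    · rw [Set.indicator_of_notMem (by simpa using hω), add_zero]
      exact le_of_lt hω
    · rw [Set.indicator_of_mem (by simpa using hω)]
      linarith [hC (F (X n k ω)) ⟨_, rfl⟩]
  calc ∫ ω, ‖F (X n k ω)‖ ∂(P n)
      ≤ ∫ ω, (ε / 2 + {ω | X n k ω ∉ U}.indicator (fun _ => C) ω) ∂(P n) :=
        integral_mono_of_nonneg (ae_of_all _ fun _ => norm_nonneg _)
          ((integrable_const _).add ((integrable_const C).indicator hmeas)) (ae_of_all _ hle)
    _ = ε / 2 + (P n).real {ω | X n k ω ∉ U} * C := by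
        rw [integral_add (integrable_const _) ((integrable_const C).indicator hmeas),
          integral_const, integral_indicator_const _ hmeas]
        simp
    _ ≤ ε / 2 + ε / 2 / (C + 1) * (C + 1) := by
        gcongr
        linarith
    _ = ε := by
        rw [div_mul_cancel₀ _ (by positivity)]
        ring

/-- Vague convergence to a Lévy measure extends to complex test functions. -/
theorem tendsto_sum_integral_complex {η : Measure Circle} (hη : IsLevyMeasure η)
    (hX : ∀ n k, Measurable (X n k))
    (hvague : ∀ f : BoundedContinuousFunction Circle ℝ, (∀ᶠ y in 𝓝 (1 : Circle), f y = 0) →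
      Tendsto (fun n => ∑ k : Fin (K n), ∫ ω, f (X n k ω) ∂(P n)) atTop (𝓝 (∫ y, f y ∂η)))
    {F : Circle → ℂ} (hF : Continuous F) (hF0 : ∀ᶠ y in 𝓝 (1 : Circle), F y = 0) :
    Tendsto (fun n => ∑ k : Fin (K n), ∫ ω, F (X n k ω) ∂(P n)) atTop (𝓝 (∫ y, F y ∂η)) := by
  have hre := hvague (.mkOfCompact ⟨fun y => (F y).re, Complex.continuous_re.comp hF⟩)
    (by filter_upwards [hF0] with y hy; simp [hy])
  have him := hvague (.mkOfCompact ⟨fun y => (F y).im, Complex.continuous_im.comp hF⟩)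
    (by filter_upwards [hF0] with y hy; simp [hy])
  simp only [BoundedContinuousFunction.mkOfCompact_apply, ContinuousMap.coe_mk] at hre him
  have hFX : ∀ n k, Integrable (fun ω => F (X n k ω)) (P n) := fun n k => by
    obtain ⟨C, hC⟩ := (isCompact_range hF).isBounded.exists_norm_le
    exact .of_bound (hF.measurable.comp (hX n k)).aestronglyMeasurable C
      (ae_of_all _ fun ω => hC _ ⟨_, rfl⟩)
  have hFη := hη.integrable_of_eventually_eq_zero hF hF0
  have key := ((Complex.continuous_ofReal.tendsto _).comp hre).add
    (((Complex.continuous_ofReal.tendsto _).comp him).mul_const Complex.I)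
  convert key using 2 with n
  · simp only [Function.comp_apply, Complex.ofReal_sum, Finset.sum_mul, ← Finset.sum_add_distrib]
    exact Finset.sum_congr rfl fun k _ => (integral_re_add_im (hFX n k)).symm
  · exact (integral_re_add_im hFη).symm

end Array

/-! ### The Fourier transform of a single summand -/

section Summand

variable {Ω : Type*} [MeasurableSpace Ω] {P : Measure Ω} {Y : Ω → Circle}

theorem variance_localLog (hY : Measurable Y) :
    variance (fun ω => localLog (Y ω)) P =
      ∫ ω, (localLog (Y ω) - ∫ ω', localLog (Y ω') ∂P) ^ 2 ∂P :=
  variance_eq_integral (continuous_localLog.measurable.comp hY).aemeasurable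

variable [IsProbabilityMeasure P]

theorem integrable_comp_of_continuous {E : Type*} [NormedAddCommGroup E]
    [SecondCountableTopologyEither Circle E] (hY : Measurable Y)
    {F : Circle → E} (hF : Continuous F) : Integrable (fun ω => F (Y ω)) P := by
  obtain ⟨C, hC⟩ := (isCompact_range hF).isBounded.exists_norm_le
  exact .of_bound (hF.aestronglyMeasurable.comp_measurable hY) C (ae_of_all _ fun ω => hC _ ⟨_, rfl⟩)

theorem abs_integral_localLog_le (Y : Ω → Circle) : |∫ ω, localLog (Y ω) ∂P| ≤ 2 := by
  have h := norm_integral_le_of_norm_le_const (μ := P) (f := fun ω => localLog (Y ω)) (C := 2)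
    (ae_of_all _ fun ω => abs_localLog_le (Y ω))
  simpa using h

theorem variance_localLog_le (hY : Measurable Y) :
    variance (fun ω => localLog (Y ω)) P ≤ 2 * ∫ ω, ‖localLog (Y ω)‖ ∂P := by
  refine (variance_le_expectation_sq
    (continuous_localLog.measurable.comp hY).aestronglyMeasurable).trans ?_
  rw [← integral_const_mul]
  refine integral_mono (integrable_comp_of_continuous hY (continuous_localLog.pow 2))
    (integrable_comp_of_continuous hY (continuous_const.mul continuous_localLog.norm)) fun ω => ?_
  have h := abs_localLog_le (Y ω)
  simp only [Pi.pow_apply, Function.comp_apply, Real.norm_eq_abs]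
  rw [← sq_abs]
  nlinarith [abs_nonneg (localLog (Y ω))]

variable (P Y) in
/-- The number `z` for which the Fourier transform of the law of `Y` at `y ↦ y ^ ℓ` is
`exp (i ℓ m) (1 + z)`, where `m` is the mean of the local logarithm of `Y`. It is expressed through
the centred local logarithm: the row sums of the squared means `m ^ 2` of an infinitesimal array
need not be bounded, whereas those of the variances are. -/
noncomputable def centredPerturbation (ℓ : ℤ) : ℂ :=
  ∫ ω, expRemainder (ℓ * (localLog (Y ω) - ∫ ω', localLog (Y ω') ∂P)) ∂P -
    ((ℓ : ℝ) ^ 2 / 2 * variance (fun ω => localLog (Y ω)) P : ℝ) +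
    Complex.exp ((-(ℓ * ∫ ω', localLog (Y ω') ∂P) : ℝ) * Complex.I) * ∫ ω, farPart ℓ (Y ω) ∂P

theorem integral_coe_zpow_eq (hY : Measurable Y) (ℓ : ℤ) :
    ∫ ω, (Y ω : ℂ) ^ ℓ ∂P =
      Complex.exp ((ℓ * ∫ ω, localLog (Y ω) ∂P : ℝ) * Complex.I) *
        (1 + centredPerturbation P Y ℓ) := by
  set m := ∫ ω, localLog (Y ω) ∂P with hm
  have hR : Integrable (fun ω => expRemainder (ℓ * (localLog (Y ω) - m))) P :=
    integrable_comp_of_continuous hY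
      (by fun_prop : Continuous fun y => expRemainder (ℓ * (localLog y - m)))
  have hD : Integrable (fun ω => farPart ℓ (Y ω)) P :=
    integrable_comp_of_continuous hY (continuous_farPart ℓ)
  have hH : Integrable (fun ω => localLog (Y ω)) P :=
    integrable_comp_of_continuous hY continuous_localLog
  have hV : Integrable (fun ω => (localLog (Y ω) - m) ^ 2) P :=
    integrable_comp_of_continuous hY (by fun_prop : Continuous fun y => (localLog y - m) ^ 2)
  have hcentre : ∫ ω, (localLog (Y ω) - m) ∂P = 0 := by
    rw [integral_sub hH (integrable_const m), integral_const, ← hm]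
    simp
  have hA : Integrable (fun ω => (((localLog (Y ω) - m : ℝ)) : ℂ)) P :=
    (hH.sub (integrable_const m)).ofReal
  have hB : Integrable (fun ω => (((localLog (Y ω) - m) ^ 2 : ℝ) : ℂ)) P := hV.ofReal
  have hexp : ∫ ω, Complex.exp ((ℓ * (localLog (Y ω) - m) : ℝ) * Complex.I) ∂P =
      1 + (∫ ω, expRemainder (ℓ * (localLog (Y ω) - m)) ∂P -
        ((ℓ : ℝ) ^ 2 / 2 * variance (fun ω => localLog (Y ω)) P : ℝ)) := by
    have hpt : ∀ ω, Complex.exp ((ℓ * (localLog (Y ω) - m) : ℝ) * Complex.I) =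
        (1 + (ℓ : ℂ) * Complex.I * ((localLog (Y ω) - m : ℝ) : ℂ)) +
          (expRemainder (ℓ * (localLog (Y ω) - m)) -
            (ℓ : ℂ) ^ 2 / 2 * (((localLog (Y ω) - m) ^ 2 : ℝ) : ℂ)) := fun ω => by
      rw [expRemainder]
      push_cast
      ring
    simp_rw [hpt]
    have hA' := hA.const_mul ((ℓ : ℂ) * Complex.I)
    have hB' := hB.const_mul ((ℓ : ℂ) ^ 2 / 2)
    refine (integral_add ((integrable_const 1).add hA') (hR.sub hB')).trans ?_
    congr 1
    · refine (integral_add (integrable_const 1) hA').trans ?_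
      rw [integral_const_mul, integral_complex_ofReal, hcentre]
      simp
    · refine (integral_sub hR hB').trans ?_
      rw [integral_const_mul, integral_complex_ofReal, variance_localLog hY]
      push_cast
      rfl
  have hsplit : ∀ ω, (Y ω : ℂ) ^ ℓ = Complex.exp ((ℓ * m : ℝ) * Complex.I) *
      Complex.exp ((ℓ * (localLog (Y ω) - m) : ℝ) * Complex.I) + farPart ℓ (Y ω) := fun ω => by
    rw [farPart, ← Complex.exp_add]
    push_cast
    ring_nf
  have hexpint : Integrable
      (fun ω => Complex.exp ((ℓ * (localLog (Y ω) - m) : ℝ) * Complex.I)) P :=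
    integrable_comp_of_continuous hY (by fun_prop :
      Continuous fun y => Complex.exp ((ℓ * (localLog y - m) : ℝ) * Complex.I))
  have hcancel : Complex.exp ((ℓ * m : ℝ) * Complex.I) *
      Complex.exp ((-(ℓ * m) : ℝ) * Complex.I) = 1 := by
    rw [← Complex.exp_add, ← Complex.exp_zero]
    push_cast
    ring_nf
  simp_rw [hsplit]
  rw [integral_add (hexpint.const_mul _) hD, integral_const_mul, hexp, centredPerturbation, ← hm]
  linear_combination (-∫ ω, farPart ℓ (Y ω) ∂P) * hcancel

theorem norm_one_add_centredPerturbation_le (hY : Measurable Y) (ℓ : ℤ) :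
    ‖1 + centredPerturbation P Y ℓ‖ ≤ 1 := by
  have h : ‖∫ ω, (Y ω : ℂ) ^ ℓ ∂P‖ ≤ 1 := by
    have := norm_integral_le_of_norm_le_const (μ := P) (f := fun ω => (Y ω : ℂ) ^ ℓ) (C := 1)
      (ae_of_all _ fun ω => by rw [norm_zpow, Circle.norm_coe, one_zpow])
    simpa using this
  rwa [integral_coe_zpow_eq hY, norm_mul, Complex.norm_exp_ofReal_mul_I, one_mul] at h

theorem norm_centredPerturbation_le (hY : Measurable Y) (ℓ : ℤ) :
    ‖centredPerturbation P Y ℓ‖ ≤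
      4 * (ℓ : ℝ) ^ 2 * variance (fun ω => localLog (Y ω)) P + ∫ ω, ‖farPart ℓ (Y ω)‖ ∂P := by
  have hv := variance_nonneg (fun ω => localLog (Y ω)) P
  have h1 : ‖∫ ω, expRemainder (ℓ * (localLog (Y ω) - ∫ ω', localLog (Y ω') ∂P)) ∂P‖ ≤
      3 * (ℓ : ℝ) ^ 2 * variance (fun ω => localLog (Y ω)) P := by
    rw [variance_localLog hY, ← integral_const_mul]
    refine norm_integral_le_of_norm_le (integrable_comp_of_continuous hY (by fun_prop :
      Continuous fun y => 3 * (ℓ : ℝ) ^ 2 * (localLog y - ∫ ω', localLog (Y ω') ∂P) ^ 2))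
      (ae_of_all _ fun ω => ?_)
    exact (norm_expRemainder_le_sq _).trans_eq (by ring)
  have h2 : ‖(((ℓ : ℝ) ^ 2 / 2 * variance (fun ω => localLog (Y ω)) P : ℝ) : ℂ)‖ =
      (ℓ : ℝ) ^ 2 / 2 * variance (fun ω => localLog (Y ω)) P := by
    rw [Complex.norm_real, Real.norm_of_nonneg (by positivity)]
  rw [centredPerturbation]
  refine (norm_add_le _ _).trans (add_le_add ((norm_sub_le _ _).trans ?_) ?_)
  · rw [h2]
    nlinarith [mul_nonneg (sq_nonneg (ℓ : ℝ)) hv]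
  · rw [norm_mul, Complex.norm_exp_ofReal_mul_I, one_mul]
    exact norm_integral_le_integral_norm _

end Summand

/-! ### Row sums of the perturbations -/

/-- A continuous cutoff of the local logarithm: `0` where it is at most `ε` in absolute value, and
`1` where it is at least `2 ε`. -/
noncomputable def cutoff (ε : ℝ) (y : Circle) : ℝ := min 1 (max 0 (|localLog y| / ε - 1))

@[fun_prop]
theorem continuous_cutoff (ε : ℝ) : Continuous (cutoff ε) := by
  unfold cutoff
  fun_prop

theorem cutoff_nonneg (ε : ℝ) (y : Circle) : 0 ≤ cutoff ε y :=
  le_min zero_le_one (le_max_left _ _)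

theorem cutoff_le_one (ε : ℝ) (y : Circle) : cutoff ε y ≤ 1 := min_le_left _ _

theorem cutoff_eq_one {ε : ℝ} (hε : 0 < ε) {y : Circle} (hy : 2 * ε ≤ |localLog y|) :
    cutoff ε y = 1 := by
  have h : 2 ≤ |localLog y| / ε := (le_div_iff₀ hε).2 hy
  exact min_eq_left (le_max_of_le_right (by linarith))

theorem cutoff_eventually_eq_zero {ε : ℝ} (hε : 0 < ε) :
    ∀ᶠ y in 𝓝 (1 : Circle), cutoff ε y = 0 := by
  have h : Tendsto (fun y => |localLog y|) (𝓝 1) (𝓝 0) := by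
    simpa [localLog_one] using (continuous_localLog.abs.tendsto 1)
  filter_upwards [h.eventually (gt_mem_nhds hε)] with y hy
  have h1 : |localLog y| / ε - 1 ≤ 0 := by
    rw [sub_nonpos, div_le_one hε]
    exact hy.le
  rw [cutoff, max_eq_left h1, min_eq_right zero_le_one]

/-- Where the cutoff is not `1`, the remainder is negligible compared with the squares of the
centred local logarithm; centring by a small number `m` is allowed. -/
theorem norm_expRemainder_mul_one_sub_cutoff_le (ℓ : ℤ) {ε m : ℝ} (hε : 0 < ε) (hm : |m| ≤ ε)
    (y : Circle) :
    ‖expRemainder (ℓ * (localLog y - m)) * ((1 - cutoff ε y : ℝ) : ℂ)‖ ≤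
      9 * |(ℓ : ℝ)| ^ 3 * ε * (localLog y - m) ^ 2 := by
  rcases le_or_gt (2 * ε) |localLog y| with hy | hy
  · rw [cutoff_eq_one hε hy]
    simp only [sub_self, Complex.ofReal_zero, mul_zero, norm_zero]
    positivity
  · have h1 : |localLog y - m| ≤ 3 * ε := (abs_sub _ _).trans (by linarith)
    rw [norm_mul, Complex.norm_real, Real.norm_of_nonneg (by linarith [cutoff_le_one ε y])]
    calc ‖expRemainder (ℓ * (localLog y - m))‖ * (1 - cutoff ε y)
        ≤ (3 * |(ℓ : ℝ) * (localLog y - m)| ^ 3) * 1 := by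
          gcongr
          · linarith [cutoff_le_one ε y]
          · exact norm_expRemainder_le_cube _
          · linarith [cutoff_nonneg ε y]
      _ = 3 * |(ℓ : ℝ)| ^ 3 * (|localLog y - m| * (localLog y - m) ^ 2) := by
          rw [abs_mul, ← sq_abs (localLog y - m)]
          ring
      _ ≤ 3 * |(ℓ : ℝ)| ^ 3 * (3 * ε * (localLog y - m) ^ 2) := by gcongr
      _ = _ := by ring

/-- Where the cutoff is positive, centring by a small number changes the remainder little. -/
theorem norm_expRemainder_sub_mul_cutoff_le (ℓ : ℤ) {ε m : ℝ} (hm : |m| ≤ 2) (y : Circle) :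
    ‖(expRemainder (ℓ * (localLog y - m)) - expRemainder (ℓ * localLog y)) *
        (cutoff ε y : ℂ)‖ ≤
      |(ℓ : ℝ)| * (2 + 6 * |(ℓ : ℝ)|) * |m| * cutoff ε y := by
  have hy := abs_localLog_le y
  have h1 : |localLog y - m| ≤ 4 := (abs_sub _ _).trans (by linarith)
  rw [norm_mul, Complex.norm_real, Real.norm_of_nonneg (cutoff_nonneg ε y)]
  refine mul_le_mul_of_nonneg_right ?_ (cutoff_nonneg ε y)
  refine (norm_expRemainder_sub_le _ _).trans ?_
  rw [← mul_sub, abs_mul, abs_mul, abs_mul, sub_sub_cancel_left, abs_neg]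
  calc |(ℓ : ℝ)| * |m| * (2 + |(ℓ : ℝ)| * |localLog y - m| + |(ℓ : ℝ)| * |localLog y|)
      ≤ |(ℓ : ℝ)| * |m| * (2 + |(ℓ : ℝ)| * 4 + |(ℓ : ℝ)| * 2) := by gcongr
    _ = _ := by ring

section Array

variable {K : ℕ → ℕ} {Ω : ℕ → Type*} [∀ n, MeasurableSpace (Ω n)]
  {P : (n : ℕ) → Measure (Ω n)}
  {X : (n : ℕ) → Fin (K n) → Ω n → Circle} {η : Measure Circle}

theorem tendsto_sum_integral_norm_farPart
    (hvague : ∀ f : BoundedContinuousFunction Circle ℝ, (∀ᶠ y in 𝓝 (1 : Circle), f y = 0) →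
      Tendsto (fun n => ∑ k : Fin (K n), ∫ ω, f (X n k ω) ∂(P n)) atTop (𝓝 (∫ y, f y ∂η)))
    (ℓ : ℤ) :
    Tendsto (fun n => ∑ k : Fin (K n), ∫ ω, ‖farPart ℓ (X n k ω)‖ ∂(P n)) atTop
      (𝓝 (∫ y, ‖farPart ℓ y‖ ∂η)) :=
  hvague (.mkOfCompact ⟨fun y => ‖farPart ℓ y‖, (continuous_farPart ℓ).norm⟩) (by
    filter_upwards [farPart_eventually_eq_zero ℓ] with y hy
    simp [hy])

variable [∀ n, IsProbabilityMeasure (P n)]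

theorem IsInfinitesimal.eventually_abs_mean_le (hinf : IsInfinitesimal P X)
    (hX : ∀ n k, Measurable (X n k)) {ε : ℝ} (hε : 0 < ε) :
    ∀ᶠ n in atTop, ∀ k, |∫ ω, localLog (X n k ω) ∂(P n)| ≤ ε := by
  filter_upwards [hinf.eventually_integral_norm_le hX continuous_localLog localLog_one hε]
    with n hn k
  exact (norm_integral_le_integral_norm _).trans (hn k)

/-- The row sums of the means of the second-order remainder converge. The cutoff splits off a part
to which vague convergence applies; the rest is bounded by a small multiple of the variances. -/
theorem tendsto_sum_integral_expRemainder (hη : IsLevyMeasure η)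
    (hX : ∀ n k, Measurable (X n k)) (hinf : IsInfinitesimal P X) {s : ℝ}
    (hvar : Tendsto (fun n => ∑ k : Fin (K n), variance (fun ω => localLog (X n k ω)) (P n))
      atTop (𝓝 s))
    (hvague : ∀ f : BoundedContinuousFunction Circle ℝ, (∀ᶠ y in 𝓝 (1 : Circle), f y = 0) →
      Tendsto (fun n => ∑ k : Fin (K n), ∫ ω, f (X n k ω) ∂(P n)) atTop (𝓝 (∫ y, f y ∂η)))
    (ℓ : ℤ) :
    Tendsto (fun n => ∑ k : Fin (K n), ∫ ω, expRemainder
      (ℓ * (localLog (X n k ω) - ∫ ω', localLog (X n k ω') ∂(P n))) ∂(P n)) atTop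
      (𝓝 (∫ y, expRemainder (ℓ * localLog y) ∂η)) := by
  set L : ℝ := |(ℓ : ℝ)| with hL
  have hL0 : 0 ≤ L := abs_nonneg _
  have hQ0 : 0 ≤ ∫ y, localLog y ^ 2 ∂η := integral_nonneg fun y => sq_nonneg _
  refine tendsto_of_forall_approx (C := 9 * L ^ 3 * (|s| + 1) + L * (2 + 6 * L) +
    9 * L ^ 3 * ∫ y, localLog y ^ 2 ∂η) fun ε hε => ?_
  have hFc : Continuous fun y => expRemainder (ℓ * localLog y) * (cutoff ε y : ℂ) := by fun_prop
  have hF0 : ∀ᶠ y in 𝓝 (1 : Circle), expRemainder (ℓ * localLog y) * (cutoff ε y : ℂ) = 0 := by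
    filter_upwards [cutoff_eventually_eq_zero hε] with y hy
    simp [hy]
  refine ⟨_, _, tendsto_sum_integral_complex hη hX hvague hFc hF0, ?_, ?_⟩
  · rw [norm_sub_rev, ← integral_sub (hη.integrable_expRemainder ℓ)
      (hη.integrable_of_eventually_eq_zero hFc hF0)]
    calc ‖∫ y, (expRemainder (ℓ * localLog y) -
          expRemainder (ℓ * localLog y) * (cutoff ε y : ℂ)) ∂η‖
        ≤ ∫ y, 9 * L ^ 3 * ε * localLog y ^ 2 ∂η := by
          refine norm_integral_le_of_norm_le (hη.integrable_localLog_sq.const_mul _)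
            (ae_of_all _ fun y => ?_)
          have h := norm_expRemainder_mul_one_sub_cutoff_le ℓ hε (m := 0) (by simpa using hε.le) y
          simp only [sub_zero] at h
          refine le_trans (le_of_eq ?_) h
          push_cast
          ring_nf
      _ = 9 * L ^ 3 * (∫ y, localLog y ^ 2 ∂η) * ε := by
          rw [integral_const_mul]
          ring
      _ ≤ _ := by
          gcongr
          exact le_add_of_nonneg_left (by positivity)
  · set B : ℝ := ∫ y, cutoff ε y ∂η with hB
    have hB0 : 0 ≤ B := integral_nonneg fun y => cutoff_nonneg ε y
    have hcut := hvague (.mkOfCompact ⟨cutoff ε, continuous_cutoff ε⟩)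
      (cutoff_eventually_eq_zero hε)
    simp only [BoundedContinuousFunction.mkOfCompact_apply, ContinuousMap.coe_mk] at hcut
    filter_upwards [hvar.eventually (gt_mem_nhds (show s < |s| + 1 by linarith [le_abs_self s])),
      hcut.eventually (gt_mem_nhds (lt_add_one B)),
      hinf.eventually_abs_mean_le hX (show 0 < min ε (ε / (B + 1)) by positivity)]
      with n hnv hnc hnm
    set m : Fin (K n) → ℝ := fun k => ∫ ω', localLog (X n k ω') ∂(P n) with hm
    have hterm : ∀ k, ‖∫ ω, expRemainder (ℓ * (localLog (X n k ω) - m k)) ∂(P n) -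
        ∫ ω, expRemainder (ℓ * localLog (X n k ω)) * (cutoff ε (X n k ω) : ℂ) ∂(P n)‖ ≤
        9 * L ^ 3 * ε * variance (fun ω => localLog (X n k ω)) (P n) +
          L * (2 + 6 * L) * (ε / (B + 1)) * ∫ ω, cutoff ε (X n k ω) ∂(P n) := by
      intro k
      have hR : Continuous fun y => expRemainder (ℓ * (localLog y - m k)) := by fun_prop
      have hV : Continuous fun y => 9 * L ^ 3 * ε * (localLog y - m k) ^ 2 := by fun_prop
      have hW : Continuous fun y => L * (2 + 6 * L) * (ε / (B + 1)) * cutoff ε y := by fun_prop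
      rw [← integral_sub (integrable_comp_of_continuous (hX n k) hR)
        (integrable_comp_of_continuous (hX n k) hFc), variance_localLog (hX n k),
        ← integral_const_mul, ← integral_const_mul,
        ← integral_add (integrable_comp_of_continuous (hX n k) hV)
          (integrable_comp_of_continuous (hX n k) hW)]
      refine norm_integral_le_of_norm_le (integrable_comp_of_continuous (hX n k) (hV.add hW))
        (ae_of_all _ fun ω => ?_)
      have h1 := norm_expRemainder_mul_one_sub_cutoff_le ℓ hε ((hnm k).trans (min_le_left _ _))
        (X n k ω)
      have h2 := norm_expRemainder_sub_mul_cutoff_le ℓ (ε := ε)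
        (abs_integral_localLog_le (P := P n) (X n k)) (X n k ω)
      have h3 : |m k| ≤ ε / (B + 1) := (hnm k).trans (min_le_right _ _)
      calc _ = ‖expRemainder (ℓ * (localLog (X n k ω) - m k)) *
              ((1 - cutoff ε (X n k ω) : ℝ) : ℂ) +
            (expRemainder (ℓ * (localLog (X n k ω) - m k)) -
              expRemainder (ℓ * localLog (X n k ω))) * (cutoff ε (X n k ω) : ℂ)‖ := by
            push_cast
            ring_nf
        _ ≤ 9 * L ^ 3 * ε * (localLog (X n k ω) - m k) ^ 2 +
            L * (2 + 6 * L) * |m k| * cutoff ε (X n k ω) :=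
          (norm_add_le _ _).trans (add_le_add h1 h2)
        _ ≤ _ := by
          have := cutoff_nonneg ε (X n k ω)
          gcongr
    rw [← Finset.sum_sub_distrib]
    calc _ ≤ ∑ k, (9 * L ^ 3 * ε * variance (fun ω => localLog (X n k ω)) (P n) +
          L * (2 + 6 * L) * (ε / (B + 1)) * ∫ ω, cutoff ε (X n k ω) ∂(P n)) :=
          (norm_sum_le _ _).trans (Finset.sum_le_sum fun k _ => hterm k)
      _ ≤ 9 * L ^ 3 * ε * (|s| + 1) + L * (2 + 6 * L) * (ε / (B + 1)) * (B + 1) := by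
          rw [Finset.sum_add_distrib, ← Finset.mul_sum, ← Finset.mul_sum]
          gcongr
      _ = (9 * L ^ 3 * (|s| + 1) + L * (2 + 6 * L)) * ε := by
          field_simp
      _ ≤ _ := mul_le_mul_of_nonneg_right (le_add_of_nonneg_right (by positivity)) hε.le

theorem tendsto_sum_rotated_integral_farPart (hη : IsLevyMeasure η)
    (hX : ∀ n k, Measurable (X n k)) (hinf : IsInfinitesimal P X)
    (hvague : ∀ f : BoundedContinuousFunction Circle ℝ, (∀ᶠ y in 𝓝 (1 : Circle), f y = 0) →
      Tendsto (fun n => ∑ k : Fin (K n), ∫ ω, f (X n k ω) ∂(P n)) atTop (𝓝 (∫ y, f y ∂η)))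
    (ℓ : ℤ) :
    Tendsto (fun n => ∑ k : Fin (K n),
      Complex.exp ((-(ℓ * ∫ ω', localLog (X n k ω') ∂(P n)) : ℝ) * Complex.I) *
        ∫ ω, farPart ℓ (X n k ω) ∂(P n)) atTop (𝓝 (∫ y, farPart ℓ y ∂η)) := by
  set B : ℝ := ∫ y, ‖farPart ℓ y‖ ∂η with hB
  have hB0 : 0 ≤ B := integral_nonneg fun y => norm_nonneg _
  refine tendsto_of_forall_approx (C := |(ℓ : ℝ)| * (B + 1)) fun ε hε =>
    ⟨_, _, tendsto_sum_integral_complex hη hX hvague (continuous_farPart ℓ)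
      (farPart_eventually_eq_zero ℓ), by simp; positivity, ?_⟩
  filter_upwards [hinf.eventually_abs_mean_le hX hε,
    (tendsto_sum_integral_norm_farPart hvague ℓ).eventually (gt_mem_nhds (lt_add_one B))]
    with n hnm hnB
  rw [← Finset.sum_sub_distrib]
  calc _ ≤ ∑ k, |(ℓ : ℝ)| * ε * ∫ ω, ‖farPart ℓ (X n k ω)‖ ∂(P n) := by
        refine (norm_sum_le _ _).trans (Finset.sum_le_sum fun k _ => ?_)
        have h := norm_exp_sub_exp_le (-(ℓ * ∫ ω', localLog (X n k ω') ∂(P n))) 0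
        simp only [Complex.ofReal_zero, zero_mul, Complex.exp_zero, sub_zero, abs_neg,
          abs_mul] at h
        rw [← sub_one_mul, norm_mul]
        gcongr
        · exact h.trans (mul_le_mul_of_nonneg_left (hnm k) (abs_nonneg _))
        · exact norm_integral_le_integral_norm _
    _ ≤ |(ℓ : ℝ)| * ε * (B + 1) := by
        rw [← Finset.mul_sum]
        gcongr
    _ = _ := by ring

/-- Convergence of the products of the centred Fourier transforms. -/
theorem tendsto_prod_one_add_centredPerturbation (hη : IsLevyMeasure η)
    (hX : ∀ n k, Measurable (X n k)) (hinf : IsInfinitesimal P X) {b : ℝ}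
    (hvar : Tendsto (fun n => ∑ k : Fin (K n), variance (fun ω => localLog (X n k ω)) (P n))
      atTop (𝓝 (b + ∫ y, localLog y ^ 2 ∂η)))
    (hvague : ∀ f : BoundedContinuousFunction Circle ℝ, (∀ᶠ y in 𝓝 (1 : Circle), f y = 0) →
      Tendsto (fun n => ∑ k : Fin (K n), ∫ ω, f (X n k ω) ∂(P n)) atTop (𝓝 (∫ y, f y ∂η)))
    (ℓ : ℤ) :
    Tendsto (fun n => ∏ k : Fin (K n), (1 + centredPerturbation (P n) (X n k) ℓ)) atTop
      (𝓝 (Complex.exp (-((torusQuadraticForm b ℓ : ℝ) : ℂ) / 2) * Complex.exp (∫ y : Circle,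
        (((torusChar ℓ y : Circle) : ℂ) - 1 - Complex.I * (torusInner y ℓ : ℂ)) ∂η))) := by
  rw [← Complex.exp_add]
  have hD := tendsto_sum_integral_norm_farPart hvague ℓ
  have hbound := (hvar.const_mul (4 * (ℓ : ℝ) ^ 2)).add hD
  refine tendsto_prod_one_add (fun n k => norm_one_add_centredPerturbation_le (hX n k) ℓ)
    (fun ε hε => ?_) (C := 4 * (ℓ : ℝ) ^ 2 * (b + ∫ y, localLog y ^ 2 ∂η) +
      ∫ y, ‖farPart ℓ y‖ ∂η + 1) ?_ ?_
  · have hc : 0 < ε / 2 / (8 * (ℓ : ℝ) ^ 2 + 1) := by positivity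
    filter_upwards [hinf.eventually_integral_norm_le hX continuous_localLog localLog_one hc,
      hinf.eventually_integral_norm_le hX (continuous_farPart ℓ)
        (farPart_eq_zero ℓ (by simp)) (half_pos hε)] with n h1 h2 k
    calc ‖centredPerturbation (P n) (X n k) ℓ‖
        ≤ 4 * (ℓ : ℝ) ^ 2 * (2 * (ε / 2 / (8 * (ℓ : ℝ) ^ 2 + 1))) + ε / 2 := by
          refine (norm_centredPerturbation_le (hX n k) ℓ).trans ?_
          gcongr
          · refine (variance_localLog_le (hX n k)).trans ?_
            gcongr
            exact h1 k
          · exact h2 k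
      _ ≤ (8 * (ℓ : ℝ) ^ 2 + 1) * (ε / 2 / (8 * (ℓ : ℝ) ^ 2 + 1)) + ε / 2 := by nlinarith
      _ = ε := by
          rw [mul_div_cancel₀ _ (by positivity)]
          ring
  · filter_upwards [hbound.eventually (gt_mem_nhds (lt_add_one _))] with n hn
    refine le_trans ?_ hn.le
    rw [Finset.mul_sum, ← Finset.sum_add_distrib]
    exact Finset.sum_le_sum fun k _ => norm_centredPerturbation_le (hX n k) ℓ
  · have hlim := ((tendsto_sum_integral_expRemainder hη hX hinf hvar hvague ℓ).sub
      ((Complex.continuous_ofReal.tendsto _).comp (hvar.const_mul ((ℓ : ℝ) ^ 2 / 2)))).add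
      (tendsto_sum_rotated_integral_farPart hη hX hinf hvague ℓ)
    convert hlim using 2 with n
    · simp only [centredPerturbation, Function.comp_apply, Finset.sum_add_distrib,
        Finset.sum_sub_distrib, Finset.mul_sum, Complex.ofReal_sum]
    · rw [hη.integral_torusExponent, torusQuadraticForm]
      push_cast
      ring

/-- The Fourier transform of a row product of independent elements. -/
theorem fourierTransform_map_prod (hX : ∀ n k, Measurable (X n k))
    (hindep : ∀ n, iIndepFun (X n) (P n)) (n : ℕ) (ℓ : ℤ) :
    fourierTransform ((P n).map fun ω => ∏ k, X n k ω) (torusChar ℓ) =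
      ((Circle.exp (∑ k, ∫ ω, localLog (X n k ω) ∂(P n)) : Circle) : ℂ) ^ ℓ *
        ∏ k, (1 + centredPerturbation (P n) (X n k) ℓ) := by
  have hmeas : Measurable fun ω => ∏ k, X n k ω :=
    Finset.measurable_fun_prod _ fun k _ => hX n k
  rw [fourierTransform_torusChar, integral_map hmeas.aemeasurable
    (continuous_coe_zpow ℓ).aestronglyMeasurable]
  have hcoe : ∀ ω, ((∏ k, X n k ω : Circle) : ℂ) ^ ℓ = ∏ k, (X n k ω : ℂ) ^ ℓ := fun ω => by
    rw [Finset.prod_zpow]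
    congr 1
    exact map_prod Circle.coeHom _ _
  simp_rw [hcoe]
  rw [(hindep n).integral_fun_prod_comp (f := fun _ (y : Circle) => (y : ℂ) ^ ℓ)
    (fun k => (hX n k).aemeasurable) fun k => (continuous_coe_zpow ℓ).aestronglyMeasurable]
  simp_rw [fun k => integral_coe_zpow_eq (P := P n) (hX n k) ℓ]
  rw [Finset.prod_mul_distrib, ← Complex.exp_sum, Circle.coe_exp, ← Complex.exp_int_mul]
  congr 2
  push_cast
  rw [Finset.sum_mul, Finset.mul_sum]
  exact Finset.sum_congr rfl fun k _ => by ring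

end Array

/-! ### The limit theorem -/

theorem mainTheorem6
    (K : ℕ → ℕ) (Ω : ℕ → Type*) [∀ n, MeasurableSpace (Ω n)]
    (P : (n : ℕ) → Measure (Ω n)) [∀ n, IsProbabilityMeasure (P n)]
    (X : (n : ℕ) → Fin (K n) → Ω n → Circle)
    (hX : ∀ n k, Measurable (X n k))
    (hindep : ∀ n, iIndepFun (X n) (P n))
    (a : Circle) (b : ℝ) (hb : 0 ≤ b) (η : Measure Circle) (hη : IsLevyMeasure η)
    (h_i : ∀ ε : ℝ, 0 < ε →
      Tendsto (fun n => ⨆ k : Fin (K n), (P n).real {ω | ε < |torusArg (X n k ω)|})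
        atTop (𝓝 0))
    (h_ii : Tendsto
      (fun n => Circle.exp (∑ k : Fin (K n), ∫ ω, torusTrunc (torusArg (X n k ω)) ∂(P n)))
      atTop (𝓝 a))
    (h_iii : Tendsto
      (fun n => ∑ k : Fin (K n), variance (fun ω => torusTrunc (torusArg (X n k ω))) (P n))
      atTop (𝓝 (b + ∫ y, (torusTrunc (torusArg y)) ^ 2 ∂η)))
    (h_iv : ∀ f : BoundedContinuousFunction Circle ℝ, (∀ᶠ y in 𝓝 (1 : Circle), f y = 0) →
      Tendsto (fun n => ∑ k : Fin (K n), ∫ ω, f (X n k ω) ∂(P n)) atTop (𝓝 (∫ y, f y ∂η))) :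
    IsInfinitesimal P X ∧
    (∃! γ : ProbabilityMeasure Circle, IsTorusGauss b γ) ∧
    (∃! ρ : ProbabilityMeasure Circle, IsTorusGeneralizedPoisson η ρ) ∧
    ∀ γ ρ : ProbabilityMeasure Circle, IsTorusGauss b γ → IsTorusGeneralizedPoisson η ρ →
      TendstoInDistribution (fun n ω => ∏ k : Fin (K n), X n k ω) atTop
        (id : Circle → Circle) P
        (Measure.dirac a ∗ₘ ((γ : Measure Circle) ∗ₘ (ρ : Measure Circle))) := by
  have hinf : IsInfinitesimal P X := isInfinitesimal_of_tendsto_torusArg h_i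
  refine ⟨hinf, existsUnique_isTorusGauss hb, existsUnique_isTorusGeneralizedPoisson hη,
    fun γ ρ hγ hρ => ?_⟩
  have hmeas : ∀ n, Measurable fun ω => ∏ k : Fin (K n), X n k ω := fun n =>
    Finset.measurable_fun_prod _ fun k _ => hX n k
  refine ⟨fun n => (hmeas n).aemeasurable, aemeasurable_id, ?_⟩
  refine tendsto_of_tendsto_fourierTransform fun ℓ => ?_
  simp only [ProbabilityMeasure.coe_mk, Measure.map_id]
  rw [fourierTransform_mconv, fourierTransform_mconv, fourierTransform_dirac, hγ ℓ, (hρ ℓ).2]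
  simp_rw [fourierTransform_map_prod hX hindep]
  exact (((continuous_coe_zpow ℓ).tendsto a).comp h_ii).mul
    (tendsto_prod_one_add_centredPerturbation hη hX hinf h_iii h_iv ℓ)
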